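/- Kummer congruences. Let $B_n$ denote the $n$-th Bernoulli number, defined by $\frac{x}{e^x-1}=\sum_{n\ge 0}B_n\frac{x^n}{n!}$. For a prime $p$, call a rational number a $p$-integer if $p$ does not divide its denominator in lowest terms; for an integer $m\ge 0$ and rational numbers $x,y$, write $x\equiv y \bmod p^m$ if $x$ and $y$ are $p$-integers and $x-y=p^m z$ for some $p$-integer $z$. Let $p$ be a prime, let $a$ be a nonnegative integer, and let $r,s$ be even positive integers such that $p-1\nmid r$ and $r\equiv s \bmod p^a(p-1)$. Then $$(1-p^{r-1})\frac{B_r}{r}\equiv(1-p^{s-1})\frac{B_s}{s} \bmod p^{a+1}.$$ In particular, both sides are $p$-integers. -/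

import Mathlib

/-- A rational number `x` is a `p`-integer if `p` does not divide its denominator in lowest
terms, i.e. if `x` lies in the localization of `ℤ` at the prime `p`. -/
def IsPInteger (p : ℕ) (x : ℚ) : Prop :=
  ¬ p ∣ x.den

/-- Congruence of `p`-integers modulo `p ^ m`: both `x` and `y` are `p`-integers, and their
difference is `p ^ m` times a `p`-integer. -/
def PCongr (p m : ℕ) (x y : ℚ) : Prop :=
  IsPInteger p x ∧ IsPInteger p y ∧ ∃ z : ℚ, IsPInteger p z ∧ x - y = (p : ℚ) ^ m * z

/-!
The congruence follows from a `p`-adic limit formula of Voronoi type. Let `b` be prime to `p` and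
`k > 0`. Then in `ℚ_[p]`

`(b ^ k - 1) * ((1 - p ^ (k - 1)) * (B_k / k)) = lim_M ∑ ⌊b j / p ^ M⌋ * (b j) ^ (k - 1)`,

the sum running over the `j < p ^ M` that are prime to `p` (`tendsto_voronoiSum`).

To see this, put `N = p ^ M` and let `S` be the sum of the `j ^ k` over these `j`. Multiplication by
`b` permutes the units modulo `N`, so that `S = ∑ (b j - N ⌊b j / N⌋) ^ k`, and the binomial
expansion modulo `N ^ 2` gives `(b ^ k - 1) S ≡ k N ∑ ⌊b j / N⌋ (b j) ^ (k - 1)`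
(`exists_sum_coprime_pow_eq`). By Faulhaber's formula, `S / N` tends to `(1 - p ^ (k - 1)) B_k`
(`tendsto_sum_coprime_pow_div`); it remains to divide by `k N`.

The sums on the right-hand side are integers, and by Euler's theorem they depend modulo `p ^ (a + 1)`
only on `k` modulo `φ (p ^ (a + 1)) = p ^ a * (p - 1)`. Both properties pass to the limit, because
closed balls are closed. Finally, if `p - 1 ∤ r`, then `b` can be chosen with `b ^ r ≢ 1` modulo `p`,
and the factors `b ^ r - 1` and `b ^ s - 1`, which are congruent units, can be removed.
-/

/-! ### Sums over the residues prime to `p` -/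

/-- The natural numbers below `n` that are not divisible by `p`. -/
def coprimesBelow (p n : ℕ) : Finset ℕ :=
  (Finset.range n).filter fun j => ¬ p ∣ j

/-- The Voronoi sum `∑ ⌊b j / p ^ M⌋ * (b j) ^ (k - 1)` over the `j < p ^ M` prime to `p`. -/
def voronoiSum (p b k M : ℕ) : ℕ :=
  ∑ j ∈ coprimesBelow p (p ^ M), b * j / p ^ M * (b * j) ^ (k - 1)

theorem mem_coprimesBelow {p n j : ℕ} : j ∈ coprimesBelow p n ↔ j < n ∧ ¬ p ∣ j := by
  simp [coprimesBelow]

theorem sum_coprimesBelow_mul_mod {α : Type*} [AddCommMonoid α] {p b M : ℕ} (hp : p.Prime)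
    (hb : ¬ p ∣ b) (f : ℕ → α) :
    ∑ j ∈ coprimesBelow p (p ^ M), f (b * j % p ^ M) = ∑ j ∈ coprimesBelow p (p ^ M), f j := by
  have hmaps : ∀ j ∈ coprimesBelow p (p ^ M), b * j % p ^ M ∈ coprimesBelow p (p ^ M) := by
    intro j hj
    rw [mem_coprimesBelow] at hj ⊢
    refine ⟨Nat.mod_lt _ (pow_pos hp.pos _), fun h => ?_⟩
    have hM : M ≠ 0 := by
      rintro rfl
      have : j = 0 := by simpa using hj.1
      exact hj.2 (this ▸ dvd_zero p)
    exact (hp.dvd_mul.1 ((Nat.dvd_mod_iff (dvd_pow_self p hM)).1 h)).elim hb hj.2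
  have hinj : Set.InjOn (fun j => b * j % p ^ M) (coprimesBelow p (p ^ M)) := by
    intro i hi j hj hij
    have hcop : (p ^ M).Coprime b := ((hp.coprime_iff_not_dvd).2 hb).pow_left M
    have h : i ≡ j [MOD p ^ M] := Nat.ModEq.cancel_left_of_coprime hcop hij
    exact h.eq_of_lt_of_lt (mem_coprimesBelow.1 hi).1 (mem_coprimesBelow.1 hj).1
  have himage : (coprimesBelow p (p ^ M)).image (fun j => b * j % p ^ M) =
      coprimesBelow p (p ^ M) :=
    Finset.eq_of_subset_of_card_le (Finset.image_subset_iff.2 hmaps)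
      (Finset.card_image_of_injOn hinj).ge
  conv_rhs => rw [← himage]
  rw [Finset.sum_image hinj]

/-- The binomial expansion of `∑ (b * j - N * ⌊b * j / N⌋) ^ k` modulo `N ^ 2`, with `N = p ^ M`. -/
theorem exists_sum_coprime_pow_eq {p b : ℕ} (hp : p.Prime) (hb : ¬ p ∣ b) (k M : ℕ) :
    ∃ e : ℤ, ((b : ℤ) ^ k - 1) * ∑ j ∈ coprimesBelow p (p ^ M), (j : ℤ) ^ k =
      (p : ℤ) ^ M * k * voronoiSum p b k M + ((p : ℤ) ^ M) ^ 2 * e := by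
  have hexp : ∀ j : ℕ, ∃ c : ℤ, ((b * j % p ^ M : ℕ) : ℤ) ^ k = (b : ℤ) ^ k * (j : ℤ) ^ k
      - (p : ℤ) ^ M * k * ((b * j / p ^ M * (b * j) ^ (k - 1) : ℕ) : ℤ)
      - ((p : ℤ) ^ M) ^ 2 * c := by
    intro j
    obtain ⟨c, hc⟩ := Polynomial.powAddExpansion ((b : ℤ) * j)
      (-((p : ℤ) ^ M * ((b * j / p ^ M : ℕ) : ℤ))) k
    refine ⟨-(c * ((b * j / p ^ M : ℕ) : ℤ) ^ 2), ?_⟩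
    have hmod : ((b * j % p ^ M : ℕ) : ℤ) =
        (b : ℤ) * j + -((p : ℤ) ^ M * ((b * j / p ^ M : ℕ) : ℤ)) := by
      have h : ((b * j % p ^ M + p ^ M * (b * j / p ^ M) : ℕ) : ℤ) = ((b * j : ℕ) : ℤ) := by
        rw [Nat.mod_add_div]
      rw [Nat.cast_add, Nat.cast_mul (p ^ M), Nat.cast_pow, Nat.cast_mul b j] at h
      linarith
    rw [hmod, hc, mul_pow (b : ℤ), Nat.cast_mul (b * j / p ^ M), Nat.cast_pow (b * j),
      Nat.cast_mul b j]
    ring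
  choose c hc using hexp
  refine ⟨∑ j ∈ coprimesBelow p (p ^ M), c j, ?_⟩
  have hsum := sum_coprimesBelow_mul_mod (M := M) hp hb (fun j => (j : ℤ) ^ k)
  simp only [hc, Finset.sum_sub_distrib, ← Finset.mul_sum] at hsum
  rw [voronoiSum, Nat.cast_sum]
  linear_combination hsum

theorem sum_range_mul_pow_eq {p : ℕ} (hp : 0 < p) (n k : ℕ) :
    ∑ j ∈ Finset.range (p * n), (j : ℚ) ^ k =
      ∑ j ∈ coprimesBelow p (p * n), (j : ℚ) ^ k
        + (p : ℚ) ^ k * ∑ j ∈ Finset.range n, (j : ℚ) ^ k := by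
  have himage : (Finset.range (p * n)).filter (p ∣ ·) = (Finset.range n).image (p * ·) := by
    ext j
    simp only [Finset.mem_filter, Finset.mem_range, Finset.mem_image]
    constructor
    · rintro ⟨hj, i, rfl⟩
      exact ⟨i, lt_of_mul_lt_mul_left hj (Nat.zero_le p), rfl⟩
    · rintro ⟨i, hi, rfl⟩
      exact ⟨Nat.mul_lt_mul_of_pos_left hi hp, dvd_mul_right p i⟩
  rw [← Finset.sum_filter_add_sum_filter_not (Finset.range (p * n)) (p ∣ ·), himage,
    Finset.sum_image fun i _ j _ h => Nat.eq_of_mul_eq_mul_left hp h, Finset.mul_sum, add_comm]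
  simp only [coprimesBelow, Nat.cast_mul, mul_pow]

theorem pow_modEq_pow_of_modEq {p a x m n : ℕ} (hp : p.Prime) (hx : ¬ p ∣ x)
    (hmn : m ≡ n [MOD p ^ a * (p - 1)]) : x ^ m ≡ x ^ n [MOD p ^ (a + 1)] := by
  have hcop : x.Coprime (p ^ (a + 1)) := ((hp.coprime_iff_not_dvd.2 hx).pow_left (a + 1)).symm
  have h1 : 1 < p ^ (a + 1) := Nat.one_lt_pow a.succ_ne_zero hp.one_lt
  have hφ : (p ^ (a + 1)).totient = p ^ a * (p - 1) := Nat.totient_prime_pow_succ hp a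
  have hmod : m % (p ^ (a + 1)).totient = n % (p ^ (a + 1)).totient := hφ ▸ hmn
  rw [Nat.ModEq, Nat.pow_totient_mod h1 hcop, hmod, ← Nat.pow_totient_mod h1 hcop]

theorem voronoiSum_modEq {p a b r s : ℕ} (hp : p.Prime) (hb : ¬ p ∣ b) (hr : 0 < r) (hs : 0 < s)
    (hrs : r ≡ s [MOD p ^ a * (p - 1)]) (M : ℕ) :
    voronoiSum p b r M ≡ voronoiSum p b s M [MOD p ^ (a + 1)] := by
  have hpred : r - 1 ≡ s - 1 [MOD p ^ a * (p - 1)] :=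
    Nat.ModEq.add_right_cancel' 1 (by rwa [Nat.sub_add_cancel hr, Nat.sub_add_cancel hs])
  exact Nat.ModEq.sum fun j hj => Nat.ModEq.mul_left _ <| pow_modEq_pow_of_modEq hp
    (fun h => (hp.dvd_mul.1 h).elim hb (mem_coprimesBelow.1 hj).2) hpred

/-! ### Limits in `ℚ_[p]` -/

section Limits

open Filter Topology

variable {p : ℕ} [Fact p.Prime]

theorem tendsto_padic_natCast_pow : Tendsto (fun M : ℕ => (p : ℚ_[p]) ^ M) atTop (𝓝 0) :=
  tendsto_pow_atTop_nhds_zero_of_norm_lt_one Padic.norm_p_lt_one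

/-- The Bernoulli number `B_k` is the derivative at `0` of the Faulhaber polynomial
`∑ j < n, j ^ k`. -/
theorem tendsto_sum_range_pow_div (k : ℕ) :
    Tendsto (fun M : ℕ => ((∑ j ∈ Finset.range (p ^ M), (j : ℚ) ^ k : ℚ) : ℚ_[p]) / (p : ℚ_[p]) ^ M)
      atTop (𝓝 ((bernoulli k : ℚ) : ℚ_[p])) := by
  have hp0 : (p : ℚ_[p]) ≠ 0 := by exact_mod_cast (Fact.out : p.Prime).ne_zero
  set F : ℚ_[p] → ℚ_[p] := fun x => ∑ i ∈ Finset.range (k + 1),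
    ((bernoulli i : ℚ) : ℚ_[p]) * ((k + 1).choose i) * x ^ (k - i) / (k + 1) with hF
  have hk : (k : ℚ_[p]) + 1 ≠ 0 := by exact_mod_cast k.succ_ne_zero
  have hF0 : F 0 = ((bernoulli k : ℚ) : ℚ_[p]) := by
    rw [hF]
    simp only
    rw [Finset.sum_range_succ, Finset.sum_eq_zero, zero_add, Nat.sub_self, pow_zero, mul_one,
      Nat.choose_succ_self_right, Nat.cast_succ, mul_div_cancel_right₀ _ hk]
    intro i hi
    rw [zero_pow (Nat.sub_ne_zero_of_lt (Finset.mem_range.1 hi)), mul_zero, zero_div]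
  have hcont : Continuous F := by fun_prop
  have h := (hcont.tendsto 0).comp (tendsto_padic_natCast_pow (p := p))
  rw [hF0] at h
  refine h.congr fun M => ?_
  rw [sum_range_pow, eq_div_iff (pow_ne_zero M hp0)]
  simp only [hF, Function.comp_apply, Finset.sum_mul]
  push_cast
  refine Finset.sum_congr rfl fun i hi => ?_
  rw [Nat.succ_sub (Finset.mem_range_succ_iff.1 hi), pow_succ]
  ring

theorem tendsto_sum_coprime_pow_div {k : ℕ} (hk : 0 < k) :
    Tendsto (fun M : ℕ => (∑ j ∈ coprimesBelow p (p ^ M), (j : ℚ_[p]) ^ k) / (p : ℚ_[p]) ^ M)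
      atTop (𝓝 ((1 - (p : ℚ_[p]) ^ (k - 1)) * ((bernoulli k : ℚ) : ℚ_[p]))) := by
  have hp0 : (p : ℚ_[p]) ≠ 0 := by exact_mod_cast (Fact.out : p.Prime).ne_zero
  have h := tendsto_sum_range_pow_div (p := p) k
  rw [← tendsto_add_atTop_iff_nat 1, sub_mul, one_mul]
  refine (((tendsto_add_atTop_iff_nat 1).2 h).sub
    (h.const_mul ((p : ℚ_[p]) ^ (k - 1)))).congr fun M => ?_
  obtain ⟨k, rfl⟩ := Nat.exists_eq_succ_of_ne_zero hk.ne'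
  rw [pow_succ' p M, sum_range_mul_pow_eq (Fact.out : p.Prime).pos]
  push_cast
  rw [Nat.succ_eq_add_one]
  field_simp
  ring

theorem tendsto_voronoiSum {b k : ℕ} (hb : ¬ p ∣ b) (hk : 0 < k) :
    Tendsto (fun M : ℕ => (voronoiSum p b k M : ℚ_[p])) atTop
      (𝓝 (((b : ℚ_[p]) ^ k - 1) *
        ((((1 - (p : ℚ) ^ (k - 1)) * (bernoulli k / (k : ℚ)) : ℚ)) : ℚ_[p]))) := by
  have hp0 : (p : ℚ_[p]) ≠ 0 := by exact_mod_cast (Fact.out : p.Prime).ne_zero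
  have hk0 : (k : ℚ_[p]) ≠ 0 := by exact_mod_cast hk.ne'
  choose e he using exists_sum_coprime_pow_eq (Fact.out : p.Prime) hb k
  -- The error terms are `p ^ M / k` times integers, which are bounded in `ℚ_[p]`.
  have herr : Tendsto (fun M : ℕ => (p : ℚ_[p]) ^ M * (e M : ℚ_[p])) atTop (𝓝 0) :=
    tendsto_padic_natCast_pow.zero_mul_isBoundedUnder_le
      (isBoundedUnder_of ⟨1, fun M => Padic.norm_int_le_one (e M)⟩)
  have h := (((tendsto_sum_coprime_pow_div (p := p) hk).const_mul
    ((b : ℚ_[p]) ^ k - 1)).sub herr).div_const (k : ℚ_[p])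
  convert h using 2 with M
  · have hM := congrArg (Int.cast : ℤ → ℚ_[p]) (he M)
    push_cast at hM
    rw [← mul_div_assoc, hM]
    field_simp
    ring
  · push_cast
    ring

end Limits

/-! ### Congruences of rational numbers and `p`-adic norms -/

theorem isPInteger_iff_norm_le_one {p : ℕ} [Fact p.Prime] {x : ℚ} :
    IsPInteger p x ↔ ‖(x : ℚ_[p])‖ ≤ 1 := by
  refine ⟨Padic.norm_rat_le_one, fun h hdvd => ?_⟩
  have hden := PadicInt.isUnit_iff.1 (PadicInt.isUnit_den x h)
  have hlt := Padic.norm_natCast_lt_one_iff.2 hdvd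
  rw [PadicInt.norm_def, PadicInt.coe_natCast] at hden
  exact hlt.ne hden

theorem pCongr_of_norm_sub_le {p m : ℕ} [Fact p.Prime] {x y : ℚ} (hx : ‖(x : ℚ_[p])‖ ≤ 1)
    (hy : ‖(y : ℚ_[p])‖ ≤ 1) (hxy : ‖(x : ℚ_[p]) - y‖ ≤ (p : ℝ) ^ (-m : ℤ)) :
    PCongr p m x y := by
  have hp : p ≠ 0 := (Fact.out : p.Prime).ne_zero
  have hpm : (0 : ℝ) < (p : ℝ) ^ (-m : ℤ) := zpow_pos (by exact_mod_cast hp.pos) _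
  have hp0 : (p : ℚ) ≠ 0 := by exact_mod_cast hp
  refine ⟨isPInteger_iff_norm_le_one.2 hx, isPInteger_iff_norm_le_one.2 hy,
    (x - y) / (p : ℚ) ^ m, isPInteger_iff_norm_le_one.2 ?_, ?_⟩
  · push_cast
    rw [norm_div, Padic.norm_p_pow]
    exact (div_le_one hpm).2 hxy
  · rw [mul_div_cancel₀ _ (pow_ne_zero m hp0)]

/-- The unit group modulo `p` has exponent `p - 1`. -/
theorem exists_not_dvd_pow_sub_one {p r : ℕ} [Fact p.Prime] (h : ¬ (p - 1) ∣ r) :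
    ∃ b : ℕ, ¬ p ∣ b ∧ ¬ (p : ℤ) ∣ (b : ℤ) ^ r - 1 := by
  have hex : ∃ u : (ZMod p)ˣ, u ^ r ≠ 1 := by
    by_contra! hall
    have := (FiniteField.forall_pow_eq_one_iff (ZMod p) r).1 hall
    rw [ZMod.card] at this
    exact h this
  obtain ⟨u, hu⟩ := hex
  refine ⟨(u : ZMod p).val, fun hdvd => u.ne_zero ?_, fun hdvd => hu (Units.ext ?_)⟩
  · simpa using (ZMod.natCast_eq_zero_iff (u : ZMod p).val p).2 hdvd
  · have := (ZMod.intCast_zmod_eq_zero_iff_dvd _ p).2 hdvd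
    push_cast at this
    rw [ZMod.natCast_zmod_val, sub_eq_zero] at this
    simpa using this

theorem norm_natCast_sub_natCast_le {p m x y : ℕ} [Fact p.Prime] (h : x ≡ y [MOD p ^ m]) :
    ‖(x : ℚ_[p]) - y‖ ≤ (p : ℝ) ^ (-m : ℤ) := by
  have hdvd := (Padic.norm_int_le_pow_iff_dvd (p := p) ((x : ℤ) - y) m).2
    (by exact_mod_cast (Nat.modEq_iff_dvd.1 h.symm))
  exact_mod_cast hdvd

/-! ### The Kummer congruences -/

theorem mainTheorem1 (p : ℕ) (hp : p.Prime) (a r s : ℕ)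
    (hr : 0 < r) (hs : 0 < s) (hr_even : Even r) (hs_even : Even s)
    (hpr : ¬ (p - 1) ∣ r) (hrs : r ≡ s [MOD p ^ a * (p - 1)]) :
    PCongr p (a + 1)
      ((1 - (p : ℚ) ^ (r - 1)) * (bernoulli r / (r : ℚ)))
      ((1 - (p : ℚ) ^ (s - 1)) * (bernoulli s / (s : ℚ))) := by
  have : Fact p.Prime := ⟨hp⟩
  obtain ⟨b, hb, hbr⟩ := exists_not_dvd_pow_sub_one (p := p) hpr
  have hpow : b ^ r ≡ b ^ s [MOD p ^ (a + 1)] := pow_modEq_pow_of_modEq hp hb hrs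
  have hbs : ¬ (p : ℤ) ∣ (b : ℤ) ^ s - 1 := fun h => hbr <| by
    have hdvd : (p : ℤ) ∣ (b : ℤ) ^ r - (b : ℤ) ^ s := by
      exact_mod_cast Nat.modEq_iff_dvd.1 (hpow.symm.of_dvd (dvd_pow_self p a.succ_ne_zero))
    simpa using dvd_add hdvd h
  have hunit : ∀ {k : ℕ}, ¬ (p : ℤ) ∣ (b : ℤ) ^ k - 1 → ‖(b : ℚ_[p]) ^ k - 1‖ = 1 := by
    intro k hk
    have hle := Padic.norm_int_le_one (p := p) ((b : ℤ) ^ k - 1)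
    have hlt := mt Padic.norm_intCast_lt_one_iff.1 hk
    push_cast at hle hlt
    exact hle.antisymm (not_lt.1 hlt)
  have hR := tendsto_voronoiSum (p := p) hb hr
  have hS := tendsto_voronoiSum (p := p) hb hs
  generalize (1 - (p : ℚ) ^ (r - 1)) * (bernoulli r / (r : ℚ)) = x at hR ⊢
  generalize (1 - (p : ℚ) ^ (s - 1)) * (bernoulli s / (s : ℚ)) = y at hS ⊢
  have hle : ∀ {k : ℕ} {z : ℚ_[p]},
      Filter.Tendsto (fun M => (voronoiSum p b k M : ℚ_[p])) Filter.atTop (nhds z) → ‖z‖ ≤ 1 :=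
    fun h => le_of_tendsto h.norm
      (Filter.Eventually.of_forall fun M => by exact_mod_cast Padic.norm_int_le_one _)
  have hx : ‖(x : ℚ_[p])‖ ≤ 1 := by
    simpa only [norm_mul, hunit hbr, one_mul] using hle hR
  have hy : ‖(y : ℚ_[p])‖ ≤ 1 := by
    simpa only [norm_mul, hunit hbs, one_mul] using hle hS
  have hlim : ‖((b : ℚ_[p]) ^ r - 1) * x - ((b : ℚ_[p]) ^ s - 1) * y‖ ≤
      (p : ℝ) ^ (-(a + 1 : ℕ) : ℤ) :=
    le_of_tendsto (hR.sub hS).norm (Filter.Eventually.of_forall fun M =>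
      norm_natCast_sub_natCast_le (voronoiSum_modEq hp hb hr hs hrs M))
  have hb_sub : ‖(b : ℚ_[p]) ^ r - (b : ℚ_[p]) ^ s‖ ≤ (p : ℝ) ^ (-(a + 1 : ℕ) : ℤ) := by
    simpa using norm_natCast_sub_natCast_le hpow
  refine pCongr_of_norm_sub_le hx hy ?_
  have hfactor : ((b : ℚ_[p]) ^ r - 1) * (x - y) =
      (((b : ℚ_[p]) ^ r - 1) * x - ((b : ℚ_[p]) ^ s - 1) * y) -
        ((b : ℚ_[p]) ^ r - (b : ℚ_[p]) ^ s) * y := by ring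
  -- Since `b ^ r - 1` is a unit, it suffices to bound its product with `x - y`.
  rw [← one_mul ‖(x : ℚ_[p]) - y‖, ← hunit hbr, ← norm_mul, hfactor, sub_eq_add_neg]
  refine (IsUltrametricDist.norm_add_le_max _ _).trans (max_le hlim ?_)
  rw [norm_neg, norm_mul]
  exact (mul_le_of_le_one_right (norm_nonneg _) hy).trans hb_sub
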